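/- Let $S_N$ be the set of permutations of $\{1,\dots,N\}$, written in one-line notation. For $\tau\in S_m$ and $\sigma\in S_N$, an occurrence of $\tau$ in $\sigma$ is a set of $m$ positions such that the restriction of $\sigma$ to these positions is order isomorphic to $\tau$. Let $g(\tau,\sigma)$ be the number of occurrences of $\tau$ in $\sigma$, let $g(\tau,N)=\max_{\sigma\in S_N}g(\tau,\sigma)$, and call $\sigma\in S_N$ $\tau$-maximal if $g(\tau,\sigma)=g(\tau,N)$. For $\alpha\ge 2$ let $\tau_{\alpha,\alpha}=[1,2,\dots,\alpha,2\alpha,2\alpha-1,\dots,\alpha+1]\in S_{2\alpha}$. Proposition. For all integers $\alpha\ge 2$ and $n\ge 0$, $$g(\tau_{\alpha,\alpha},2n)=\binom{n}{\alpha}^2,$$ and this maximum is attained by the permutation $[1,2,\dots,n,2n,2n-1,\dots,n+1]\in S_{2n}$. Moreover, if $n\ge\alpha$, this permutation is the only $\tau_{\alpha,\alpha}$-maximal permutation in $S_{2n}$. Thus, for $n \ge \alpha$, the maximizing permutation does not depend on $\alpha$. -/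

import Mathlib

/-- Let `τ` be a permutation of size `m` (the pattern) and `σ` a permutation of size `n`.  A set
`S` of positions of `σ` is an occurrence of `τ` in `σ` if it has exactly `m` elements and the
restriction of `σ` to `S`, read in increasing order of positions, is order isomorphic to `τ`. -/
def IsOccurrence {m n : ℕ} (τ : Equiv.Perm (Fin m)) (σ : Equiv.Perm (Fin n))
    (S : Finset (Fin n)) : Prop :=
  ∃ h : S.card = m, ∀ i j : Fin m,
    σ (S.orderEmbOfFin h i) < σ (S.orderEmbOfFin h j) ↔ τ i < τ j

instance {m n : ℕ} (τ : Equiv.Perm (Fin m)) (σ : Equiv.Perm (Fin n)) (S : Finset (Fin n)) :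
    Decidable (IsOccurrence τ σ S) := by
  unfold IsOccurrence
  infer_instance

/-- The number `g(τ, σ)` of occurrences of the pattern `τ` in `σ`. -/
def numOccurrences {m n : ℕ} (τ : Equiv.Perm (Fin m)) (σ : Equiv.Perm (Fin n)) : ℕ :=
  (Finset.univ.filter (fun S : Finset (Fin n) => IsOccurrence τ σ S)).card

/-- `g(τ, n)`: the maximum of `g(τ, σ)` over all permutations `σ` of size `n`. -/
def maxOccurrences {m : ℕ} (τ : Equiv.Perm (Fin m)) (n : ℕ) : ℕ :=
  (Finset.univ : Finset (Equiv.Perm (Fin n))).sup' Finset.univ_nonempty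
    (fun σ => numOccurrences τ σ)

/-- `σ` is `τ`-maximal: no permutation of the same size has more occurrences of `τ`. -/
def IsPatternMaximal {m n : ℕ} (τ : Equiv.Perm (Fin m)) (σ : Equiv.Perm (Fin n)) : Prop :=
  numOccurrences τ σ = maxOccurrences τ n

/-- The one-line notation of `[1, 2, …, k, 2k, 2k - 1, …, k + 1]`, with positions and values
counted from `0`: it is `[0, 1, …, k - 1, 2k - 1, 2k - 2, …, k]`. -/
def blockFun (k : ℕ) (i : Fin (2 * k)) : Fin (2 * k) :=
  if h : i.val < k then i else ⟨3 * k - 1 - i.val, by omega⟩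

theorem blockFun_involutive (k : ℕ) : Function.Involutive (blockFun k) := by
  intro i
  have hi := i.isLt
  by_cases h : i.val < k
  · simp [blockFun, h]
  · have h2 : ¬ 3 * k - 1 - i.val < k := by omega
    apply Fin.ext
    simp only [blockFun, h, h2, dite_false]
    omega

/-- The permutation `[1, 2, …, k, 2k, 2k - 1, …, k + 1]` of size `2k`: an antilayer of size `k`
followed by a layer of size `k`.  As a pattern, with `k = α`, it is `τ_{α,α}`. -/
def blockPerm (k : ℕ) : Equiv.Perm (Fin (2 * k)) :=
  (blockFun_involutive k).toPerm (blockFun k)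

/-! Attach to `σ` the order `permRel σ` on positions. In an occurrence of the pattern the first half
of the positions is a chain and the second half an antichain above it, so the occurrences are at
most as many as the chain-antichain pairs. It suffices to show that a strict order on `2 * n`
elements has at most `n.choose k ^ 2` such pairs, with equality only for a chain of size `n` below
an antichain of size `n`; for `permRel σ` that shape determines `σ`.

The bound on orders is a Zykov symmetrization. If `x` and `y` are incomparable, replacing `y` by a
copy of `x` changes the number of pairs by at least `deg x - deg y`, where `deg` counts the pairs
through an element. The opposite replacement changes it by at least the negative of this, so both
keep an optimal order optimal, and neither creates a new pair through both elements. Repeated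
cloning leads to an order in which incomparable elements are twins, that is, a stack of layers.
Rigidity under cloning carries the block shape back to the original order
(`isBlock_of_isBlock_cloneRel`), which gives uniqueness.

For layers, let `S` be the set below the lowest layer with at least two elements, and `T` the top
layer. Suppose that this lowest layer is not `T`. If `S` is smaller than `T`, turning the layer into
a chain gains pairs (`card_lt_card_layerToChain`). Otherwise merging the two top layers loses
nothing (`card_add_le_card_mergeTop`), and equality forces `S` and `T` to fill everything, a
contradiction. What remains is a chain below an antichain, and `choose_mul_choose_lt` balances the
sizes. -/

/-! ### Strict orders and chain-antichain pairs -/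

/-- A relation that is irreflexive and transitive. -/
def IsStrict {V : Type*} (r : V → V → Prop) : Prop :=
  (∀ a, ¬ r a a) ∧ ∀ a b c, r a b → r b c → r a c

/-- A pair `(A, B)` of `k`-element sets: a chain `A` all of whose elements lie below the
antichain `B`. -/
def IsChainAntichain {V : Type*} (r : V → V → Prop) (k : ℕ) (p : Finset V × Finset V) : Prop :=
  p.1.card = k ∧ p.2.card = k ∧ (∀ a ∈ p.1, ∀ b ∈ p.1, a ≠ b → r a b ∨ r b a) ∧
    (∀ a ∈ p.2, ∀ b ∈ p.2, ¬ r a b) ∧ ∀ a ∈ p.1, ∀ b ∈ p.2, r a b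

/-- The element `v` belongs to one of the two sets of `p`. -/
def Uses {V : Type*} (p : Finset V × Finset V) (v : V) : Prop := v ∈ p.1 ∨ v ∈ p.2

open Classical in
/-- All chain-antichain pairs of size `k`. -/
noncomputable def chainAntichains {V : Type*} [Fintype V] (r : V → V → Prop) (k : ℕ) :
    Finset (Finset V × Finset V) :=
  Finset.univ.filter (IsChainAntichain r k)

theorem mem_chainAntichains {V : Type*} [Fintype V] {r : V → V → Prop} {k : ℕ}
    {p : Finset V × Finset V} : p ∈ chainAntichains r k ↔ IsChainAntichain r k p := by
  simp [chainAntichains]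

/-- The relation in which `y` is replaced by a copy of `x`. -/
def cloneRel {V : Type*} [DecidableEq V] (r : V → V → Prop) (x y : V) : V → V → Prop :=
  fun u v => r (if u = y then x else u) (if v = y then x else v)

/-- A strict order with the largest number of chain-antichain pairs. -/
def IsOptimal {V : Type*} [Fintype V] (k : ℕ) (r : V → V → Prop) : Prop :=
  IsStrict r ∧ ∀ r' : V → V → Prop, IsStrict r' →
    (chainAntichains r' k).card ≤ (chainAntichains r k).card

/-! ### Cloning an element -/

section
variable {V : Type*} {r : V → V → Prop} {k : ℕ}

theorem IsStrict.cloneRel [DecidableEq V] (h : IsStrict r) (x y : V) : IsStrict (cloneRel r x y) :=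
  ⟨fun _ => h.1 _, fun _ _ _ => h.2 _ _ _⟩

theorem IsChainAntichain.map {r' : V → V → Prop} {p : Finset V × Finset V}
    (h : IsChainAntichain r k p) (e : V ≃ V)
    (he : ∀ u v, Uses p u → Uses p v → (r u v ↔ r' (e u) (e v))) :
    IsChainAntichain r' k (p.1.map e.toEmbedding, p.2.map e.toEmbedding) := by
  obtain ⟨h1, h2, h3, h4, h5⟩ := h
  refine ⟨by simpa using h1, by simpa using h2, ?_, ?_, ?_⟩
  · simp only [Finset.mem_map, Equiv.toEmbedding_apply]
    rintro _ ⟨a, ha, rfl⟩ _ ⟨b, hb, rfl⟩ hab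
    rw [← he a b (Or.inl ha) (Or.inl hb), ← he b a (Or.inl hb) (Or.inl ha)]
    exact h3 a ha b hb (fun h => hab (by rw [h]))
  · simp only [Finset.mem_map, Equiv.toEmbedding_apply]
    rintro _ ⟨a, ha, rfl⟩ _ ⟨b, hb, rfl⟩
    rw [← he a b (Or.inr ha) (Or.inr hb)]
    exact h4 a ha b hb
  · simp only [Finset.mem_map, Equiv.toEmbedding_apply]
    rintro _ ⟨a, ha, rfl⟩ _ ⟨b, hb, rfl⟩
    rw [← he a b (Or.inl ha) (Or.inr hb)]
    exact h5 a ha b hb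

/-- Chain elements are comparable to every other element of the pair, so two incomparable elements
of a pair both lie in its antichain. There the copy of `x` can stand in for `y`. -/
theorem IsChainAntichain.cloneRel [DecidableEq V] {x y : V} (hr : IsStrict r)
    (hxy : ¬ r x y) (hyx : ¬ r y x) {p : Finset V × Finset V} (hp : IsChainAntichain r k p)
    (hx : Uses p x) (hy : Uses p y) (hne : x ≠ y) :
    IsChainAntichain (cloneRel r x y) k p ∧ x ∈ p.2 ∧ y ∈ p.2 := by
  obtain ⟨h1, h2, h3, h4, h5⟩ := hp
  have hx2 : x ∈ p.2 := by
    rcases hx with hx | hx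
    · rcases hy with hy | hy
      · exact ((h3 x hx y hy hne).elim hxy hyx).elim
      · exact (hxy (h5 x hx y hy)).elim
    · exact hx
  have hy2 : y ∈ p.2 := by
    rcases hy with hy | hy
    · exact (hyx (h5 y hy x hx2)).elim
    · exact hy
  have hy1 : ∀ a ∈ p.1, a ≠ y := by
    rintro a ha rfl
    exact hr.1 a (h5 a ha a hy2)
  have key : ∀ b ∈ p.2, (if b = y then x else b) ∈ p.2 := by
    intro b hb
    split_ifs <;> assumption
  refine ⟨⟨h1, h2, ?_, ?_, ?_⟩, hx2, hy2⟩
  · intro a ha b hb hab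
    simpa [_root_.cloneRel, hy1 a ha, hy1 b hb] using h3 a ha b hb hab
  · intro a ha b hb
    exact h4 _ (key a ha) _ (key b hb)
  · intro a ha b hb
    simpa [_root_.cloneRel, hy1 a ha] using h5 a ha _ (key b hb)

variable [Fintype V] [DecidableEq V]

-- Three disjoint families live in the cloned order: the pairs avoiding `y`, the pairs through `x`
-- but not `y` with `x` renamed to `y`, and the given family `K` of pairs through both.
open Classical in
theorem card_chainAntichains_cloneRel {x y : V} (hxy : x ≠ y)
    (K : Finset (Finset V × Finset V)) (hK : K ⊆ chainAntichains (cloneRel r x y) k)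
    (hK' : ∀ p ∈ K, Uses p x ∧ Uses p y) :
    (chainAntichains r k).card +
        ((chainAntichains r k).filter fun p => Uses p x ∧ ¬ Uses p y).card + K.card ≤
      (chainAntichains (cloneRel r x y) k).card +
        ((chainAntichains r k).filter fun p => Uses p y).card := by
  set O := chainAntichains r k with hO
  set e : V ≃ V := Equiv.swap x y
  set f : Finset V × Finset V ↪ Finset V × Finset V :=
    ⟨fun p => (p.1.map e.toEmbedding, p.2.map e.toEmbedding), by
      rintro ⟨a, b⟩ ⟨c, d⟩ h
      simpa using h⟩ with hf
  have huse : ∀ p v, Uses (f p) v ↔ Uses p (e.symm v) := by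
    intro p v
    change v ∈ p.1.map e.toEmbedding ∨ v ∈ p.2.map e.toEmbedding ↔ _
    rw [Finset.mem_map_equiv, Finset.mem_map_equiv, Uses]
  set X := O.filter fun p => ¬ Uses p y
  set Y := (O.filter fun p => Uses p x ∧ ¬ Uses p y).map f with hY
  have hYu : ∀ p ∈ Y, Uses p y ∧ ¬ Uses p x := by
    intro p hp
    obtain ⟨p', hp', rfl⟩ := Finset.mem_map.1 hp
    rw [huse, huse]
    simpa [e] using (Finset.mem_filter.1 hp').2
  have hX : X ⊆ chainAntichains (cloneRel r x y) k := by
    intro p hp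
    obtain ⟨hp, hy⟩ := Finset.mem_filter.1 hp
    have := (mem_chainAntichains.1 hp).map (r' := cloneRel r x y) (Equiv.refl V) (by
      intro u v hu hv
      have h1 : u ≠ y := by rintro rfl; exact hy hu
      have h2 : v ≠ y := by rintro rfl; exact hy hv
      simp [cloneRel, h1, h2])
    rw [mem_chainAntichains]
    simpa using this
  have hYs : Y ⊆ chainAntichains (cloneRel r x y) k := by
    intro p hp
    obtain ⟨p', hp', rfl⟩ := Finset.mem_map.1 hp
    obtain ⟨hp', -, hy⟩ := Finset.mem_filter.1 hp'
    rw [mem_chainAntichains]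
    refine (mem_chainAntichains.1 hp').map e ?_
    have key : ∀ u, Uses p' u → (if e u = y then x else e u) = u := by
      intro u hu
      have h1 : u ≠ y := by rintro rfl; exact hy hu
      by_cases h2 : u = x
      · subst h2; simp [e]
      · simp [e, Equiv.swap_apply_of_ne_of_ne h2 h1, h1]
    intro u v hu hv
    simp only [cloneRel, key u hu, key v hv]
  have hd1 : Disjoint X Y := by
    rw [Finset.disjoint_left]
    intro p hp hq
    exact (Finset.mem_filter.1 hp).2 (hYu p hq).1
  have hd2 : Disjoint (X ∪ Y) K := by
    rw [Finset.disjoint_left]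
    intro p hp hq
    rcases Finset.mem_union.1 hp with hp | hp
    · exact (Finset.mem_filter.1 hp).2 (hK' p hq).2
    · exact (hYu p hp).2 (hK' p hq).1
  have := Finset.card_le_card (Finset.union_subset (Finset.union_subset hX hYs) hK)
  rw [Finset.card_union_of_disjoint hd2, Finset.card_union_of_disjoint hd1, hY,
    Finset.card_map] at this
  have h2 : (O.filter fun p => Uses p y).card + X.card = O.card := by
    convert Finset.card_filter_add_card_filter_not (s := O) (fun p => Uses p y)
  omega

-- Here `K` consists of the old pairs through both elements, which survive, and of the new ones. The
-- former complete the pairs through `x` alone to the degree of `x`.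
open Classical in
theorem card_add_degree_le_cloneRel {x y : V} (hr : IsStrict r) (hne : x ≠ y)
    (hxy : ¬ r x y) (hyx : ¬ r y x) :
    (chainAntichains r k).card + ((chainAntichains r k).filter fun p => Uses p x).card +
      ((chainAntichains (cloneRel r x y) k).filter
        fun p => (Uses p x ∧ Uses p y) ∧ ¬ IsChainAntichain r k p).card ≤
      (chainAntichains (cloneRel r x y) k).card +
        ((chainAntichains r k).filter fun p => Uses p y).card := by
  set K1 := (chainAntichains r k).filter fun p => Uses p x ∧ Uses p y with hK1
  set K2 := (chainAntichains (cloneRel r x y) k).filter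
        fun p => (Uses p x ∧ Uses p y) ∧ ¬ IsChainAntichain r k p with hK2
  have h := card_chainAntichains_cloneRel (r := r) (k := k) hne (K1 ∪ K2) (by
    intro p hp
    rcases Finset.mem_union.1 hp with hp | hp
    · obtain ⟨h1, h2, h3⟩ := Finset.mem_filter.1 hp
      exact mem_chainAntichains.2
        ((mem_chainAntichains.1 h1).cloneRel hr hxy hyx h2 h3 hne).1
    · exact (Finset.mem_filter.1 hp).1) (by
    intro p hp
    rcases Finset.mem_union.1 hp with hp | hp
    · exact (Finset.mem_filter.1 hp).2
    · exact (Finset.mem_filter.1 hp).2.1)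
  rw [Finset.card_union_of_disjoint] at h
  · have h2 : K1.card + ((chainAntichains r k).filter fun p => Uses p x ∧ ¬ Uses p y).card =
        ((chainAntichains r k).filter fun p => Uses p x).card := by
      rw [hK1, ← Finset.filter_filter, ← Finset.filter_filter]
      convert Finset.card_filter_add_card_filter_not
        (s := (chainAntichains r k).filter fun p => Uses p x) (fun p => Uses p y)
    omega
  · rw [Finset.disjoint_left]
    intro p hp hq
    exact (Finset.mem_filter.1 hq).2.2 (mem_chainAntichains.1 (Finset.mem_filter.1 hp).1)

/-- Adding the inequalities for the two directions of cloning cancels the degrees: together the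
cloned orders have at least twice the optimum, so each attains it. -/
theorem IsOptimal.cloneRel (h : IsOptimal k r) {x y : V} (hne : x ≠ y)
    (hxy : ¬ r x y) (hyx : ¬ r y x) : IsOptimal k (cloneRel r x y) := by
  classical
  refine ⟨h.1.cloneRel x y, fun r' hr' => (h.2 r' hr').trans ?_⟩
  have h1 := card_add_degree_le_cloneRel (k := k) h.1 hne hxy hyx
  have h2 := card_add_degree_le_cloneRel (k := k) h.1 hne.symm hyx hxy
  have h3 := h.2 _ (h.1.cloneRel y x)
  omega

/-- A new pair through both elements would make the sum of the two cloning inequalities exceed twice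
the optimum. -/
theorem IsOptimal.isChainAntichain_of_cloneRel (h : IsOptimal k r) {x y : V} (hne : x ≠ y)
    (hxy : ¬ r x y) (hyx : ¬ r y x) {p : Finset V × Finset V} (hx : x ∈ p.2) (hy : y ∈ p.2)
    (hp : IsChainAntichain (_root_.cloneRel r x y) k p) : IsChainAntichain r k p := by
  classical
  by_contra hn
  have h1 := card_add_degree_le_cloneRel (k := k) h.1 hne hxy hyx
  have h2 := card_add_degree_le_cloneRel (k := k) h.1 hne.symm hyx hxy
  have h3 := h.2 _ (h.1.cloneRel y x)
  have h4 := h.2 _ (h.1.cloneRel x y)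
  have h5 : 0 < ((chainAntichains (_root_.cloneRel r x y) k).filter
        fun p => (Uses p x ∧ Uses p y) ∧ ¬ IsChainAntichain r k p).card :=
    Finset.card_pos.2 ⟨p, Finset.mem_filter.2
      ⟨mem_chainAntichains.2 hp, ⟨Or.inr hx, Or.inr hy⟩, hn⟩⟩
  omega

/-- Turning an unused `y` into a copy of a used `x` would destroy no pair and create at least one.
-/
theorem IsOptimal.exists_uses (h : IsOptimal k r) (hpos : 0 < (chainAntichains r k).card)
    (hk : 0 < k) (y : V) : ∃ p, IsChainAntichain r k p ∧ Uses p y := by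
  classical
  by_contra! hn
  obtain ⟨p, hp⟩ := Finset.card_pos.1 hpos
  have hp' := mem_chainAntichains.1 hp
  obtain ⟨x, hx⟩ := Finset.card_pos.1 (hp'.1.symm ▸ hk)
  have hne : x ≠ y := by
    rintro rfl
    exact hn p hp' (Or.inl hx)
  have h1 := card_chainAntichains_cloneRel (r := r) (k := k) hne ∅ (by simp) (by simp)
  have h2 := h.2 _ (h.1.cloneRel x y)
  have h3 : ((chainAntichains r k).filter fun p => Uses p y) = ∅ :=
    Finset.filter_eq_empty_iff.2 fun q hq => hn q (mem_chainAntichains.1 hq)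
  have h4 : 0 < ((chainAntichains r k).filter fun p => Uses p x ∧ ¬ Uses p y).card :=
    Finset.card_pos.2 ⟨p, Finset.mem_filter.2 ⟨hp, Or.inl hx, hn p hp'⟩⟩
  rw [h3] at h1
  simp at h1
  simp only [Finset.card_pos] at h4
  have := Finset.card_pos.2 h4
  omega

end

/-! ### Bad pairs and the reduction to layers -/

/-- The elements `u` and `v` have the same elements above them and the same elements below them. -/
def IsTwin {V : Type*} (r : V → V → Prop) (u v : V) : Prop :=
  ∀ w, (r u w ↔ r v w) ∧ (r w u ↔ r w v)

/-- The elements `u` and `v` are incomparable, but not twins. -/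
def IsBad {V : Type*} (r : V → V → Prop) (u v : V) : Prop :=
  ¬ r u v ∧ ¬ r v u ∧ ¬ IsTwin r u v

/-- The relation consists of a chain of size `n` below an antichain. -/
def IsBlock {V : Type*} (r : V → V → Prop) (n : ℕ) : Prop :=
  ∃ S : Finset V, S.card = n ∧ (∀ s ∈ S, ∀ t ∈ S, s ≠ t → r s t ∨ r t s) ∧
    (∀ s ∈ S, ∀ t, t ∉ S → r s t) ∧ ∀ t, t ∉ S → ∀ t', t' ∉ S → ¬ r t t'

section
variable {V : Type*} {r : V → V → Prop} {k : ℕ}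

theorem IsBad.symm {u v : V} (h : IsBad r u v) : IsBad r v u :=
  ⟨h.2.1, h.1, fun ht => h.2.2 fun w => ⟨(ht w).1.symm, (ht w).2.symm⟩⟩

theorem IsBad.ne {u v : V} (h : IsBad r u v) : u ≠ v := by
  rintro rfl
  exact h.2.2 fun w => ⟨Iff.rfl, Iff.rfl⟩

theorem IsBad.of_cloneRel [DecidableEq V] {x y u v : V} (h : IsBad (cloneRel r x y) u v) :
    IsBad r (if u = y then x else u) (if v = y then x else v) :=
  ⟨h.1, h.2.1, fun ht => h.2.2 fun w => ht (if w = y then x else w)⟩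

variable [Fintype V] [DecidableEq V]

-- Bad pairs avoiding `y` were bad before. After cloning, `y` has at most the bad partners of `x`,
-- except itself, since `x` and `y` are now twins; this is fewer than `y` had.
open Classical in
theorem card_isBad_cloneRel_lt {x y : V} (h : IsBad r x y)
    (hle : (Finset.univ.filter (IsBad r x)).card ≤ (Finset.univ.filter (IsBad r y)).card) :
    (Finset.univ.filter fun p : V × V => IsBad (cloneRel r x y) p.1 p.2).card <
      (Finset.univ.filter fun p : V × V => IsBad r p.1 p.2).card := by
  set X := Finset.univ.filter (IsBad r x)
  set Y := Finset.univ.filter (IsBad r y)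
  set N := Finset.univ.filter fun p : V × V => IsBad r p.1 p.2 ∧ p.1 ≠ y ∧ p.2 ≠ y
  have hyX : y ∈ X := by simp [X, h]
  have h1 : (Finset.univ.filter fun p : V × V => IsBad (cloneRel r x y) p.1 p.2) ⊆
      N ∪ ({y} ×ˢ X.erase y ∪ X.erase y ×ˢ {y}) := by
    rintro ⟨u, v⟩ hp
    have hp : IsBad (cloneRel r x y) u v := (Finset.mem_filter.1 hp).2
    have hb := hp.of_cloneRel
    have hne := hp.ne
    by_cases hu : u = y
    · have hv : v ≠ y := fun hv => hne (hu.trans hv.symm)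
      rw [if_pos hu, if_neg hv] at hb
      simp [X, hu, hv, hb]
    · by_cases hv : v = y
      · rw [if_neg hu, if_pos hv] at hb
        simp [X, hu, hv, hb.symm]
      · rw [if_neg hu, if_neg hv] at hb
        simp [N, hu, hv, hb]
  have h2 : N ∪ ({y} ×ˢ Y ∪ Y ×ˢ {y}) ⊆ Finset.univ.filter fun p : V × V => IsBad r p.1 p.2 := by
    rintro ⟨u, v⟩ hp
    simp only [N, Y, Finset.mem_union, Finset.mem_filter, Finset.mem_univ, true_and,
      Finset.mem_product, Finset.mem_singleton] at hp ⊢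
    rcases hp with hp | ⟨rfl, hp⟩ | ⟨hp, rfl⟩
    · exact hp.1
    · exact hp
    · exact hp.symm
  have hYy : y ∉ Y := fun hy => (Finset.mem_filter.1 hy).2.ne rfl
  have h3 := Finset.card_le_card h1
  have h4 := Finset.card_le_card h2
  have h5 := Finset.card_union_le N ({y} ×ˢ X.erase y ∪ X.erase y ×ˢ {y})
  have h6 := Finset.card_union_le ({y} ×ˢ X.erase y) (X.erase y ×ˢ {y})
  rw [Finset.card_union_of_disjoint, Finset.card_union_of_disjoint] at h4
  · simp only [Finset.card_product, Finset.card_singleton, one_mul, mul_one] at h4 h6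
    have h7 := Finset.card_erase_lt_of_mem hyX
    omega
  · rw [Finset.disjoint_left]
    rintro ⟨u, v⟩ hp hq
    simp only [Finset.mem_product, Finset.mem_singleton] at hp hq
    exact hYy (hp.1 ▸ hq.1)
  · rw [Finset.disjoint_left]
    rintro ⟨u, v⟩ hp hq
    simp only [N, Finset.mem_filter, Finset.mem_union, Finset.mem_product,
      Finset.mem_singleton] at hp hq
    rcases hq with hq | hq
    · exact hp.2.2.1 hq.1
    · exact hp.2.2.2 hq.2

/-- Away from `y` the two orders agree. The cloned order has every pair with chain in `S` and
antichain in the complement; by optimality those through `x` and `y` are pairs of `r` too, and they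
reveal how `y` compares with the rest. -/
theorem isBlock_of_isBlock_cloneRel {n : ℕ} (hcard : Fintype.card V = 2 * n) (hk : 2 ≤ k)
    (hkn : k ≤ n) (h : IsOptimal k r) {x y : V} (hne : x ≠ y) (hxy : ¬ r x y) (hyx : ¬ r y x)
    (hb : IsBlock (cloneRel r x y) n) : IsBlock r n := by
  obtain ⟨S, hS, hch, hST, hT⟩ := hb
  have hirr := h.1.1
  have hyS : y ∉ S := by
    intro hy
    by_cases hx : x ∈ S
    · have := hch x hx y hy hne
      simp [cloneRel, hne, hirr] at this
    · have := hST y hy x hx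
      simp [cloneRel, hne, hirr] at this
  have hxS : x ∉ S := by
    intro hx
    have := hST x hx y hyS
    simp [cloneRel, hne, hirr] at this
  have hSy : ∀ s ∈ S, s ≠ y := by
    rintro s hs rfl
    exact hyS hs
  have hSx : ∀ s ∈ S, s ≠ x := by
    rintro s hs rfl
    exact hxS hs
  have chS : ∀ s ∈ S, ∀ t ∈ S, s ≠ t → r s t ∨ r t s := by
    intro s hs t ht hst
    simpa [cloneRel, hSy s hs, hSy t ht] using hch s hs t ht hst
  have hST' : ∀ s ∈ S, ∀ t, t ∉ S → t ≠ y → r s t := by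
    intro s hs t ht hty
    simpa [cloneRel, hSy s hs, hty] using hST s hs t ht
  have hT' : ∀ t, t ∉ S → t ≠ y → ∀ t', t' ∉ S → t' ≠ y → ¬ r t t' := by
    intro t ht hty t' ht' hty'
    simpa [cloneRel, hty, hty'] using hT t ht t' ht'
  have hTc : Sᶜ.card = n := by
    rw [Finset.card_compl, hcard, hS]
    omega
  -- every antichain of the right size in the complement is an antichain of `r`
  have hpair : ∀ A ⊆ S, A.card = k → ∀ B ⊆ Sᶜ, B.card = k → x ∈ B → y ∈ B →
      IsChainAntichain r k (A, B) := by
    intro A hA hAk B hB hBk hxB hyB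
    refine h.isChainAntichain_of_cloneRel hne hxy hyx hxB hyB ⟨hAk, hBk, ?_, ?_, ?_⟩
    · exact fun a ha b hb hab => hch a (hA ha) b (hA hb) hab
    · exact fun a ha b hb => hT a (by simpa using hB ha) b (by simpa using hB hb)
    · exact fun a ha b hb => hST a (hA ha) b (by simpa using hB hb)
  have hxySc : ({x, y} : Finset V) ⊆ Sᶜ := by
    intro u hu
    rcases Finset.mem_insert.1 hu with rfl | hu
    · simpa using hxS
    · rw [Finset.mem_singleton.1 hu]; simpa using hyS
  have hxyc : ({x, y} : Finset V).card = 2 := Finset.card_pair hne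
  have hSy' : ∀ s ∈ S, r s y := by
    intro s hs
    obtain ⟨A, hsA, hA, hAk⟩ := Finset.exists_subsuperset_card_eq
      (Finset.singleton_subset_iff.2 hs) (n := k) (by simp; omega) (by omega)
    obtain ⟨B, hxyB, hB, hBk⟩ := Finset.exists_subsuperset_card_eq hxySc (n := k)
      (by omega) (by omega)
    have hxB : x ∈ B := hxyB (by simp)
    have hyB : y ∈ B := hxyB (by simp)
    exact (hpair A hA hAk B hB hBk hxB hyB).2.2.2.2 s (hsA (by simp)) y hyB
  have hyT : ∀ t, t ∉ S → ¬ r t y ∧ ¬ r y t := by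
    intro t ht
    by_cases hty : t = y
    · subst hty; exact ⟨hirr _, hirr _⟩
    by_cases htx : t = x
    · subst htx; exact ⟨hxy, hyx⟩
    rcases Nat.lt_or_ge 2 k with hk3 | hk2
    · have hsub : ({t, x, y} : Finset V) ⊆ Sᶜ := by
        intro u hu
        rcases Finset.mem_insert.1 hu with rfl | hu
        · simpa using ht
        · exact hxySc hu
      have hc : ({t, x, y} : Finset V).card = 3 := by
        rw [Finset.card_insert_of_notMem (by simp [hty, htx]), hxyc]
      obtain ⟨A, hA, hAk⟩ := Finset.exists_subset_card_eq (s := S) (n := k) (by omega)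
      obtain ⟨B, hxyB, hB, hBk⟩ := Finset.exists_subsuperset_card_eq hsub (n := k)
        (by omega) (by omega)
      have hxB : x ∈ B := hxyB (by simp)
      have hyB : y ∈ B := hxyB (by simp)
      have htB : t ∈ B := hxyB (by simp)
      have := (hpair A hA hAk B hB hBk hxB hyB).2.2.2.1
      exact ⟨this t htB y hyB, this y hyB t htB⟩
    -- A two-element antichain has no room for `t` beside `x` and `y`. A relation between `t` and
    -- `y` is refuted by cloning another incomparable pair: copying `y` onto `x` would force `t`
    -- below `x`, and copying `t` onto `x` would force `y` below `x`.
    · obtain rfl : k = 2 := by omega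
      obtain ⟨c, hc⟩ : S.Nonempty := Finset.card_pos.1 (by omega)
      have hcy := hSy c hc
      have hcx := hSx c hc
      have rcy := hSy' c hc
      have rct := hST' c hc t ht hty
      have rcx := hST' c hc x hxS hne
      have hct : c ≠ t := by rintro rfl; exact ht hc
      have hxt := hT' x hxS hne t ht hty
      have htx' := hT' t ht hty x hxS hne
      constructor
      · intro hr
        have hp : IsChainAntichain (cloneRel r y x) 2 ({c, t}, {y, x}) := by
          refine ⟨Finset.card_pair hct, Finset.card_pair hne.symm, ?_, ?_, ?_⟩ <;>
            simp [cloneRel, hcx, htx, hirr, hne.symm, rct, rcy, hr]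
        have := h.isChainAntichain_of_cloneRel hne.symm hyx hxy (by simp) (by simp) hp
        exact htx' (this.2.2.2.2 t (by simp) x (by simp))
      · intro hr
        have hp : IsChainAntichain (cloneRel r t x) 2 ({c, y}, {t, x}) := by
          refine ⟨Finset.card_pair hcy, Finset.card_pair htx, ?_, ?_, ?_⟩ <;>
            simp [cloneRel, hcx, htx, hirr, hne.symm, rct, rcy, hr]
        have := h.isChainAntichain_of_cloneRel htx htx' hxt (by simp) (by simp) hp
        exact hyx (this.2.2.2.2 y (by simp) x (by simp))
  refine ⟨S, hS, chS, ?_, ?_⟩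
  · intro s hs t ht
    by_cases hty : t = y
    · subst hty; exact hSy' s hs
    · exact hST' s hs t ht hty
  · intro t ht t' ht'
    by_cases hty : t = y
    · subst hty; exact (hyT t' ht').2
    by_cases hty' : t' = y
    · subst hty'; exact (hyT t ht).1
    exact hT' t ht hty t' ht' hty'

open Classical in
/-- If every optimal order without bad pairs is a block order, then so is every optimal order. -/
theorem isBlock_of_forall_not_isBad {n : ℕ} (hcard : Fintype.card V = 2 * n) (hk : 2 ≤ k)
    (hkn : k ≤ n)
    (hlayer : ∀ r : V → V → Prop, IsOptimal k r → (∀ u v, ¬ IsBad r u v) → IsBlock r n)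
    (r : V → V → Prop) (h : IsOptimal k r) : IsBlock r n := by
  induction hm : (Finset.univ.filter fun p : V × V => IsBad r p.1 p.2).card
    using Nat.strong_induction_on generalizing r with
  | _ m ih =>
    by_cases hbad : ∀ u v, ¬ IsBad r u v
    · exact hlayer r h hbad
    · push Not at hbad
      obtain ⟨u, v, huv⟩ := hbad
      have key : ∀ x y, IsBad r x y → (Finset.univ.filter (IsBad r x)).card ≤
          (Finset.univ.filter (IsBad r y)).card → IsBlock r n := by
        intro x y hxy hle
        refine isBlock_of_isBlock_cloneRel hcard hk hkn h hxy.ne hxy.1 hxy.2.1 ?_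
        exact ih _ (hm ▸ card_isBad_cloneRel_lt hxy hle) _
          (h.cloneRel hxy.ne hxy.1 hxy.2.1) rfl
      rcases le_total (Finset.univ.filter (IsBad r u)).card
        (Finset.univ.filter (IsBad r v)).card with hle | hle
      · exact key u v huv hle
      · exact key v u huv.symm hle

end

/-! ### Counting pairs in block orders -/

/-- Descending factorials compare factor by factor: `(a - i) * (b - i)` has a fixed sum of factors
and is largest when they are equal. -/
theorem choose_mul_choose_lt {a b n k : ℕ} (hab : a + b = 2 * n) (hk : 0 < k) (hkn : k ≤ n)
    (hne : a ≠ n) : a.choose k * b.choose k < n.choose k ^ 2 := by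
  wlog hlt : a < b generalizing a b
  · rw [mul_comm]
    exact this (by omega) (by omega) (by omega)
  have hpos : 0 < n.choose k := Nat.choose_pos hkn
  rcases Nat.lt_or_ge a k with hak | hak
  · rw [Nat.choose_eq_zero_of_lt hak, zero_mul]
    positivity
  have h : a.descFactorial k * b.descFactorial k < n.descFactorial k * n.descFactorial k := by
    simp only [Nat.descFactorial_eq_prod_range, ← Finset.prod_mul_distrib]
    have hi : ∀ i ∈ Finset.range k, (a - i) * (b - i) < (n - i) * (n - i) := by
      intro i hi
      have hi := Finset.mem_range.1 hi
      obtain ⟨a', rfl⟩ := Nat.exists_eq_add_of_le (show i ≤ a by omega)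
      obtain ⟨b', rfl⟩ := Nat.exists_eq_add_of_le (show i ≤ b by omega)
      obtain ⟨n', rfl⟩ := Nat.exists_eq_add_of_le (show i ≤ n by omega)
      simp only [Nat.add_sub_cancel_left]
      obtain ⟨d, rfl⟩ := Nat.exists_eq_add_of_lt (show a' < n' by omega)
      obtain rfl : b' = a' + d + 1 + d + 1 := by omega
      nlinarith
    refine Finset.prod_lt_prod (fun i hi => ?_) (fun i h => (hi i h).le)
      ⟨0, Finset.mem_range.2 hk, hi 0 (Finset.mem_range.2 hk)⟩
    have hi := Finset.mem_range.1 hi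
    exact Nat.mul_pos (by omega) (by omega)
  simp only [Nat.descFactorial_eq_factorial_mul_choose] at h
  have hf : 0 < k.factorial * k.factorial := Nat.mul_pos k.factorial_pos k.factorial_pos
  refine lt_of_mul_lt_mul_left (a := k.factorial * k.factorial) ?_ hf.le
  calc _ = k.factorial * a.choose k * (k.factorial * b.choose k) := by ring
    _ < _ := h
    _ = _ := by ring

section
variable {V : Type*} [Fintype V] {k : ℕ}

theorem IsBlock.card_chainAntichains {r : V → V → Prop} {s : ℕ} (hr : IsStrict r)
    (h : IsBlock r s) (hk : 2 ≤ k) :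
    (chainAntichains r k).card = s.choose k * (Fintype.card V - s).choose k := by
  classical
  obtain ⟨S, hS, hch, hST, hT⟩ := h
  have : chainAntichains r k = S.powersetCard k ×ˢ Sᶜ.powersetCard k := by
    ext ⟨A, B⟩
    rw [mem_chainAntichains, Finset.mem_product, Finset.mem_powersetCard,
      Finset.mem_powersetCard]
    constructor
    · rintro ⟨h1, h2, -, h4, h5⟩
      refine ⟨⟨fun a ha => ?_, h1⟩, fun b hb => ?_, h2⟩
      · obtain ⟨b, hb⟩ := Finset.card_pos.1 (show 0 < B.card by simp only at h2; omega)
        have hab := h5 a ha b hb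
        by_contra haS
        by_cases hbS : b ∈ S
        · exact hr.1 _ (hr.2 _ _ _ hab (hST b hbS a haS))
        · exact hT a haS b hbS hab
      · rw [Finset.mem_compl]
        intro hbS
        obtain ⟨c, hc, hcb⟩ := Finset.exists_mem_ne (show 1 < B.card by simp only at h2; omega) b
        by_cases hcS : c ∈ S
        · exact (hch b hbS c hcS hcb.symm).elim (h4 b hb c hc) (h4 c hc b hb)
        · exact h4 b hb c hc (hST b hbS c hcS)
    · rintro ⟨⟨hA, h1⟩, hB, h2⟩
      have hB' : ∀ b ∈ B, b ∉ S := fun b hb => Finset.mem_compl.1 (hB hb)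
      exact ⟨h1, h2, fun a ha b hb => hch a (hA ha) b (hA hb),
        fun a ha b hb => hT a (hB' a ha) b (hB' b hb), fun a ha b hb => hST a (hA ha) b (hB' b hb)⟩
  rw [this, Finset.card_product, Finset.card_powersetCard, Finset.card_powersetCard,
    Finset.card_compl, hS]

theorem exists_isBlock {n : ℕ} (hn : n ≤ Fintype.card V) :
    ∃ r : V → V → Prop, IsStrict r ∧ IsBlock r n := by
  classical
  set e := Fintype.equivFin V
  have hcard : (Finset.univ.filter fun v => (e v).val < n).card = n := by
    rw [← Fintype.card_subtype, Fintype.card_congr (e.subtypeEquiv (q := fun i => i.val < n)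
      (fun _ => Iff.rfl)), Fintype.card_subtype, Fin.card_filter_val_lt]
    omega
  refine ⟨fun u v => e u < e v ∧ (e u).val < n, ⟨fun a h => lt_irrefl _ h.1,
    fun a b c h1 h2 => ⟨h1.1.trans h2.1, h1.2⟩⟩, Finset.univ.filter fun v => (e v).val < n,
    hcard, ?_, ?_, ?_⟩
  · intro s hs t ht hst
    simp only [Finset.mem_filter, Finset.mem_univ, true_and] at hs ht
    simp only [hs, ht, and_true]
    exact lt_or_gt_of_ne (fun h => hst (e.injective h))
  · intro s hs t ht
    simp only [Finset.mem_filter, Finset.mem_univ, true_and] at hs ht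
    exact ⟨Fin.lt_def.2 (by omega), hs⟩
  · intro t ht t' _
    simp only [Finset.mem_filter, Finset.mem_univ, true_and] at ht
    exact fun h => ht h.2

/-! ### Layers: turning a layer into a chain -/

/-- The rank is the number of elements below. Incomparable elements are twins, so they have equal
rank. -/
theorem exists_rank {r : V → V → Prop} (hr : IsStrict r) (hbad : ∀ u v, ¬ IsBad r u v) :
    ∃ ρ : V → ℕ, r = fun u v => ρ u < ρ v := by
  classical
  have hlt : ∀ u v, r u v →
      (Finset.univ.filter (r · u)).card < (Finset.univ.filter (r · v)).card := by
    intro u v huv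
    refine Finset.card_lt_card (Finset.ssubset_iff_of_subset ?_ |>.2 ⟨u, by simp [huv], by
      simp [hr.1]⟩)
    intro w hw
    simp only [Finset.mem_filter, Finset.mem_univ, true_and] at hw ⊢
    exact hr.2 _ _ _ hw huv
  refine ⟨fun v => (Finset.univ.filter (r · v)).card, ?_⟩
  funext u v
  refine propext ⟨hlt u v, fun h => ?_⟩
  by_contra huv
  by_cases hvu : r v u
  · exact (h.trans (hlt v u hvu)).false
  · have htw : IsTwin r u v := by
      by_contra htw
      exact hbad u v ⟨huv, hvu, htw⟩
    have : Finset.univ.filter (r · u) = Finset.univ.filter (r · v) := by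
      ext w
      simp [(htw w).2]
    simp only [this] at h
    exact h.false

/-- The relation in which the layer of rank `m` is replaced by a chain. -/
def layerToChain (ρ ι : V → ℕ) (m : ℕ) : V → V → Prop :=
  fun u v => ρ u < ρ v ∨ (ρ u = m ∧ ρ v = m ∧ ι u < ι v)

omit [Fintype V] in
theorem isStrict_layerToChain (ρ ι : V → ℕ) (m : ℕ) : IsStrict (layerToChain ρ ι m) := by
  refine ⟨fun a h => ?_, fun a b c h1 h2 => ?_⟩ <;> unfold layerToChain at * <;> omega

omit [Fintype V] in
theorem isStrict_rank (ρ : V → ℕ) : IsStrict fun u v => ρ u < ρ v :=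
  ⟨fun _ => lt_irrefl _, fun _ _ _ => lt_trans⟩

/-- A pair is lost only if its antichain meets the layer `P`; then the antichain lies in `P` and the
chain in `S`. Chains in `P` below antichains in `T` are new, and `S` is smaller than `T`. If `P` has
fewer than `k` elements nothing is lost, and a single new pair suffices. -/
theorem card_lt_card_layerToChain {ρ ι : V → ℕ} (hι : Function.Injective ι) {m M : ℕ}
    (hk : 2 ≤ k) (hm : m < M) (hP : 2 ≤ (Finset.univ.filter fun v => ρ v = m).card)
    (hT : k ≤ (Finset.univ.filter fun v => ρ v = M).card)
    (hST : (Finset.univ.filter fun v => ρ v < m).card < (Finset.univ.filter fun v => ρ v = M).card)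
    (huse : ∀ v, ∃ p, IsChainAntichain (fun u v => ρ u < ρ v) k p ∧ Uses p v) :
    (chainAntichains (fun u v => ρ u < ρ v) k).card <
      (chainAntichains (layerToChain ρ ι m) k).card := by
  classical
  set S := Finset.univ.filter fun v => ρ v < m with hS
  set P := Finset.univ.filter fun v => ρ v = m with hPdef
  set T := Finset.univ.filter fun v => ρ v = M with hTdef
  set O := chainAntichains (fun u v => ρ u < ρ v) k with hO
  set O' := chainAntichains (layerToChain ρ ι m) k with hO'
  have memP : ∀ v, v ∈ P ↔ ρ v = m := by simp [P]
  have memT : ∀ v, v ∈ T ↔ ρ v = M := by simp [T]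
  have memS : ∀ v, v ∈ S ↔ ρ v < m := by simp [S]
  have hPchain : ∀ a b, ρ a = m → ρ b = m → a ≠ b →
      layerToChain ρ ι m a b ∨ layerToChain ρ ι m b a := by
    intro a b ha hb hab
    have := hι.ne hab
    unfold layerToChain
    omega
  set O1 := O.filter fun p => ¬ ∃ b ∈ p.2, ρ b = m with hO1
  set O2 := O.filter fun p => ∃ b ∈ p.2, ρ b = m with hO2
  have h12 : O2.card + O1.card = O.card := Finset.card_filter_add_card_filter_not _
  have h1 : O1 ⊆ O' := by
    intro p hp
    obtain ⟨hp, hb⟩ := Finset.mem_filter.1 hp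
    obtain ⟨h1, h2, h3, h4, h5⟩ := mem_chainAntichains.1 hp
    refine mem_chainAntichains.2 ⟨h1, h2, ?_, ?_, ?_⟩
    · exact fun a ha b hb hab => (h3 a ha b hb hab).imp Or.inl Or.inl
    · rintro a ha b hb' (h | h)
      · exact h4 a ha b hb' h
      · exact hb ⟨a, ha, h.1⟩
    · exact fun a ha b hb => Or.inl (h5 a ha b hb)
  have hPsub : ∀ p ∈ O2, p.2 ⊆ P ∧ p.1 ⊆ S := by
    intro p hp
    obtain ⟨hp, b, hb, hbm⟩ := Finset.mem_filter.1 hp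
    obtain ⟨h1, h2, h3, h4, h5⟩ := mem_chainAntichains.1 hp
    refine ⟨fun c hc => ?_, fun a ha => ?_⟩
    · have := h4 b hb c hc
      have := h4 c hc b hb
      rw [memP]; omega
    · have := h5 a ha b hb
      rw [memS]; omega
  have h2 : O2 ⊆ S.powersetCard k ×ˢ P.powersetCard k := by
    intro p hp
    obtain ⟨hp2, hp1⟩ := hPsub p hp
    obtain ⟨h1, h2, -⟩ := mem_chainAntichains.1 (Finset.mem_filter.1 hp).1
    simp only [Finset.mem_product, Finset.mem_powersetCard]
    exact ⟨⟨hp1, h1⟩, hp2, h2⟩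
  have h2c := Finset.card_le_card h2
  rw [Finset.card_product, Finset.card_powersetCard, Finset.card_powersetCard] at h2c
  rcases Nat.lt_or_ge P.card k with hPk | hPk
  · rw [Nat.choose_eq_zero_of_lt hPk, mul_zero] at h2c
    -- a pair through `x ∈ P`, with another element of its chain replaced by a twin of `x`
    suffices ∃ p ∈ O', p ∉ O1 by
      obtain ⟨p, hp, hp'⟩ := this
      have := Finset.card_lt_card (Finset.ssubset_iff_of_subset h1 |>.2 ⟨p, hp, hp'⟩)
      omega
    obtain ⟨x, hx, x', hx', hxx'⟩ := Finset.one_lt_card.1 (show 1 < P.card by omega)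
    obtain ⟨p, hp, hpx⟩ := huse x
    have hpO : p ∈ O := mem_chainAntichains.2 hp
    have hnB : ¬ ∃ b ∈ p.2, ρ b = m := by
      intro hb
      have : p ∈ O2 := Finset.mem_filter.2 ⟨hpO, hb⟩
      have := Finset.card_pos.2 ⟨p, this⟩
      omega
    rw [memP] at hx hx'
    have hxA : x ∈ p.1 := hpx.resolve_right fun h => hnB ⟨x, h, hx⟩
    obtain ⟨h1, h2, h3, h4, h5⟩ := hp
    have hx'A : x' ∉ p.1 := by
      intro h
      have := h3 x hxA x' h hxx'
      omega
    obtain ⟨a, ha, hax⟩ := Finset.exists_mem_ne (show 1 < p.1.card by omega) x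
    have hcmp : ∀ c ∈ p.1, layerToChain ρ ι m c x' ∨ layerToChain ρ ι m x' c := by
      intro c hc
      by_cases hcx : c = x
      · subst hcx; exact hPchain _ _ hx hx' hxx'
      · have := h3 c hc x hxA hcx
        unfold layerToChain
        omega
    refine ⟨(insert x' (p.1.erase a), p.2), mem_chainAntichains.2 ⟨?_, h2, ?_, ?_, ?_⟩, ?_⟩
    · rw [Finset.card_insert_of_notMem (fun h => hx'A (Finset.mem_of_mem_erase h)),
        Finset.card_erase_of_mem ha]
      omega
    · intro u hu v hv huv
      simp only [Finset.mem_insert] at hu hv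
      rcases hu with rfl | hu <;> rcases hv with rfl | hv
      · exact (huv rfl).elim
      · exact (hcmp v (Finset.mem_of_mem_erase hv)).symm
      · exact hcmp u (Finset.mem_of_mem_erase hu)
      · exact (h3 u (Finset.mem_of_mem_erase hu) v (Finset.mem_of_mem_erase hv) huv).imp
          Or.inl Or.inl
    · rintro u hu v hv (h | h)
      · exact h4 u hu v hv h
      · exact hnB ⟨u, hu, h.1⟩
    · intro u hu v hv
      simp only [Finset.mem_insert] at hu
      left
      rcases hu with rfl | hu
      · have := h5 x hxA v hv
        omega
      · exact h5 u (Finset.mem_of_mem_erase hu) v hv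
    · intro hmem
      have := (mem_chainAntichains.1 (Finset.mem_filter.1 hmem).1).2.2.1 x
        (by simp [hxA, hax.symm]) x' (by simp) hxx'
      omega
  · set G := P.powersetCard k ×ˢ T.powersetCard k with hG
    have hGO : G ⊆ O' := by
      rintro ⟨A, B⟩ hp
      simp only [hG, Finset.mem_product, Finset.mem_powersetCard] at hp
      obtain ⟨⟨hA, hAk⟩, hB, hBk⟩ := hp
      refine mem_chainAntichains.2 ⟨hAk, hBk, ?_, ?_, ?_⟩
      · exact fun a ha b hb hab => hPchain a b ((memP a).1 (hA ha)) ((memP b).1 (hA hb)) hab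
      · intro a ha b hb
        have := (memT a).1 (hB ha)
        have := (memT b).1 (hB hb)
        unfold layerToChain
        omega
      · intro a ha b hb
        have := (memP a).1 (hA ha)
        have := (memT b).1 (hB hb)
        left
        omega
    have hdis : Disjoint O1 G := by
      rw [Finset.disjoint_left]
      rintro ⟨A, B⟩ hp hq
      simp only [hG, Finset.mem_product, Finset.mem_powersetCard] at hq
      obtain ⟨⟨hA, hAk⟩, -⟩ := hq
      obtain ⟨x, hx, x', hx', hne⟩ := Finset.one_lt_card.1 (show 1 < A.card by omega)
      have := (mem_chainAntichains.1 (Finset.mem_filter.1 hp).1).2.2.1 x hx x' hx' hne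
      have := (memP x).1 (hA hx)
      have := (memP x').1 (hA hx')
      omega
    have h3 := Finset.card_le_card (Finset.union_subset h1 hGO)
    rw [Finset.card_union_of_disjoint hdis, hG, Finset.card_product, Finset.card_powersetCard,
      Finset.card_powersetCard] at h3
    have h4 : S.card.choose k < T.card.choose k := by
      rcases Nat.lt_or_ge S.card k with h | h
      · rw [Nat.choose_eq_zero_of_lt h]; exact Nat.choose_pos hT
      · obtain ⟨j, rfl⟩ : ∃ j, k = j + 1 := ⟨k - 1, by omega⟩
        obtain ⟨t, ht⟩ : ∃ t, T.card = t + 1 := ⟨T.card - 1, by omega⟩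
        rw [ht, Nat.choose_succ_succ']
        have := Nat.choose_le_choose (j + 1) (show S.card ≤ t by omega)
        have := Nat.choose_pos (show j ≤ t by omega)
        omega
    have h5 : S.card.choose k * P.card.choose k < P.card.choose k * T.card.choose k := by
      rw [mul_comm]
      exact Nat.mul_lt_mul_of_pos_left h4 (Nat.choose_pos hPk)
    omega

end

/-! ### Layers: merging the two top ones -/

section
variable {V : Type*} [Fintype V]

open Classical in
/-- The `j`-element chains of elements of rank less than `m`. -/
noncomputable def rankChains (ρ : V → ℕ) (m j : ℕ) : Finset (Finset V) :=
  ((Finset.univ.filter fun v => ρ v < m).powersetCard j).filter fun A =>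
    ∀ a ∈ A, ∀ b ∈ A, a ≠ b → ρ a ≠ ρ b

theorem mem_rankChains {ρ : V → ℕ} {m j : ℕ} {A : Finset V} :
    A ∈ rankChains ρ m j ↔
      (∀ a ∈ A, ρ a < m) ∧ A.card = j ∧ ∀ a ∈ A, ∀ b ∈ A, a ≠ b → ρ a ≠ ρ b := by
  classical
  simp [rankChains, Finset.subset_iff, and_assoc]

/-- Elements of rank below `m₀` are comparable to everything, so any of them outside a `j`-chain
extends it. Recording the added element makes the extension injective. -/
theorem sum_inter_card_ge {ρ : V → ℕ} [DecidableEq V] {m m₀ : ℕ} (hm : m₀ ≤ m)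
    (hinj : ∀ u w, u ≠ w → ρ u = ρ w → m₀ ≤ ρ u) (j : ℕ) :
    (rankChains ρ m j).card * ((Finset.univ.filter fun v => ρ v < m₀).card - j) ≤
      ∑ A ∈ rankChains ρ m (j + 1), (A ∩ Finset.univ.filter fun v => ρ v < m₀).card := by
  set S := Finset.univ.filter fun v => ρ v < m₀ with hS
  calc _ ≤ ∑ A ∈ rankChains ρ m j, (S \ A).card := by
        rw [← smul_eq_mul]
        refine Finset.card_nsmul_le_sum _ _ _ fun A hA => ?_
        rw [← (mem_rankChains.1 hA).2.1]
        exact Finset.le_card_sdiff _ _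
    _ = ((rankChains ρ m j).sigma fun A => S \ A).card := (Finset.card_sigma _ _).symm
    _ ≤ ((rankChains ρ m (j + 1)).sigma fun A => A ∩ S).card := by
        refine Finset.card_le_card_of_injOn (fun q => ⟨insert q.2 q.1, q.2⟩) ?_ ?_
        · rintro ⟨A, d⟩ hq
          simp only [Finset.coe_sigma, Set.mem_sigma_iff, Finset.mem_coe, Finset.mem_sdiff,
            mem_rankChains] at hq
          obtain ⟨⟨h1, h2, h3⟩, hd, hdA⟩ := hq
          have hdm : ρ d < m₀ := by simpa [hS] using hd
          have hne : ∀ b, d ≠ b → ρ d ≠ ρ b := fun b hdb h => by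
            have := hinj d b hdb h
            omega
          simp only [Finset.coe_sigma, Set.mem_sigma_iff, Finset.mem_coe, Finset.mem_inter,
            Finset.mem_insert_self, hd, and_self, and_true, mem_rankChains]
          refine ⟨?_, by rw [Finset.card_insert_of_notMem hdA, h2], ?_⟩
          · intro a ha
            rcases Finset.mem_insert.1 ha with rfl | ha
            · omega
            · exact h1 a ha
          · intro a ha b hb hab
            rcases Finset.mem_insert.1 ha with rfl | ha
            · exact hne b hab
            · rcases Finset.mem_insert.1 hb with rfl | hb
              · exact (hne a hab.symm).symm
              · exact h3 a ha b hb hab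
        · rintro ⟨A, d⟩ hA ⟨A', d'⟩ hA' h
          simp only [Finset.coe_sigma, Set.mem_sigma_iff, Finset.mem_coe,
            Finset.mem_sdiff] at hA hA'
          simp only [Sigma.mk.injEq, heq_eq_eq] at h
          obtain ⟨h, rfl⟩ := h
          have : A = A' := by
            rw [← Finset.erase_insert hA.2.2, h, Finset.erase_insert hA'.2.2]
          rw [this]
    _ = _ := Finset.card_sigma _ _

theorem card_rankChains_mul_le {ρ : V → ℕ} {m m₀ : ℕ} (hm : m₀ ≤ m)
    (hinj : ∀ u w, u ≠ w → ρ u = ρ w → m₀ ≤ ρ u) (j : ℕ) :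
    (rankChains ρ m j).card * ((Finset.univ.filter fun v => ρ v < m₀).card - j) ≤
      (rankChains ρ m (j + 1)).card * (j + 1) := by
  classical
  refine (sum_inter_card_ge hm hinj j).trans ?_
  rw [← smul_eq_mul]
  refine Finset.sum_le_card_nsmul _ _ _ fun A hA => ?_
  rw [← (mem_rankChains.1 hA).2.1]
  exact Finset.card_le_card Finset.inter_subset_left

theorem exists_rankChains_below {ρ : V → ℕ} {m m₀ j : ℕ} (hm : m₀ ≤ m)
    (hinj : ∀ u w, u ≠ w → ρ u = ρ w → m₀ ≤ ρ u)
    (hj : j ≤ (Finset.univ.filter fun v => ρ v < m₀).card) :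
    ∃ A ∈ rankChains ρ m j, ∀ a ∈ A, ρ a < m₀ := by
  obtain ⟨A, hA, hAj⟩ := Finset.exists_subset_card_eq hj
  have hA' : ∀ a ∈ A, ρ a < m₀ := fun a ha => by simpa using hA ha
  refine ⟨A, mem_rankChains.2 ⟨fun a ha => (hA' a ha).trans_le hm, hAj, ?_⟩, hA'⟩
  intro a ha b _ hab h
  have := hinj a b hab h
  have := hA' a ha
  omega

/-- The double count is strict because a chain through an element of rank `m₀` does not lie entirely
below `m₀`. -/
theorem card_rankChains_mul_lt {ρ : V → ℕ} {m m₀ j : ℕ} (hm : m₀ < m)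
    (hinj : ∀ u w, u ≠ w → ρ u = ρ w → m₀ ≤ ρ u)
    (hj : j ≤ (Finset.univ.filter fun v => ρ v < m₀).card) (hx : ∃ x, ρ x = m₀) :
    (rankChains ρ m j).card * ((Finset.univ.filter fun v => ρ v < m₀).card - j) <
      (rankChains ρ m (j + 1)).card * (j + 1) := by
  classical
  refine (sum_inter_card_ge hm.le hinj j).trans_lt ?_
  rw [← smul_eq_mul, ← Finset.sum_const]
  obtain ⟨x, hx⟩ := hx
  obtain ⟨A, hA, hAm⟩ := exists_rankChains_below hm.le hinj hj
  obtain ⟨h1, h2, h3⟩ := mem_rankChains.1 hA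
  have hxA : x ∉ A := fun h => by
    have := hAm x h
    omega
  refine Finset.sum_lt_sum (fun B hB => ?_) ⟨insert x A, mem_rankChains.2 ⟨?_, ?_, ?_⟩, ?_⟩
  · rw [← (mem_rankChains.1 hB).2.1]
    exact Finset.card_le_card Finset.inter_subset_left
  · intro a ha
    rcases Finset.mem_insert.1 ha with rfl | ha
    · omega
    · exact h1 a ha
  · rw [Finset.card_insert_of_notMem hxA, h2]
  · intro a ha b hb hab
    rcases Finset.mem_insert.1 ha with ha' | ha'
    · rcases Finset.mem_insert.1 hb with hb' | hb'
      · exact (hab (ha'.trans hb'.symm)).elim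
      · have := hAm b hb'
        rw [ha']
        omega
    · rcases Finset.mem_insert.1 hb with hb' | hb'
      · have := hAm a ha'
        rw [hb']
        omega
      · exact h3 a ha' b hb' hab
  · have hsub : (insert x A ∩ Finset.univ.filter fun v => ρ v < m₀) ⊆ A := by
      intro a ha
      simp only [Finset.mem_inter, Finset.mem_insert, Finset.mem_filter, Finset.mem_univ,
        true_and] at ha
      rcases ha.1 with rfl | h
      · omega
      · exact h
    have := Finset.card_le_card hsub
    omega

/-- Merging the two top layers gains at least as much as the first product and loses at most as
much as the second. -/
theorem card_add_le_card_mergeTop {ρ : V → ℕ} {m M j : ℕ} (hj : 0 < j) (hmM : m < M) (hM : ∀ v, ρ v ≤ M)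
    (hm : ∀ v, ρ v < M → ρ v ≤ m) :
    (chainAntichains (fun u v => ρ u < ρ v) (j + 1)).card +
        (Finset.univ.filter fun v => ρ v = m).card *
          ((Finset.univ.filter fun v => ρ v = M).card.choose j *
            (rankChains ρ m (j + 1)).card) ≤
      (chainAntichains (fun u v => min (ρ u) m < min (ρ v) m) (j + 1)).card +
        (Finset.univ.filter fun v => ρ v = m).card *
          ((Finset.univ.filter fun v => ρ v = M).card.choose (j + 1) *
            (rankChains ρ m j).card) := by
  classical
  set R := Finset.univ.filter fun v => ρ v = m with hR
  set T := Finset.univ.filter fun v => ρ v = M with hT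
  set O := chainAntichains (fun u v => ρ u < ρ v) (j + 1) with hO
  set O' := chainAntichains (fun u v => min (ρ u) m < min (ρ v) m) (j + 1) with hO'
  have memR : ∀ v, v ∈ R ↔ ρ v = m := by simp [R]
  have memT : ∀ v, v ∈ T ↔ ρ v = M := by simp [T]
  set L := O.filter fun p => ∃ a ∈ p.1, ρ a = m with hL
  set K := O.filter fun p => ¬ ∃ a ∈ p.1, ρ a = m with hK
  have hLK : L.card + K.card = O.card := Finset.card_filter_add_card_filter_not _
  have hlow : ∀ p ∈ O, ∀ a ∈ p.1, ρ a ≤ m := by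
    intro p hp a ha
    obtain ⟨h1, h2, h3, h4, h5⟩ := mem_chainAntichains.1 hp
    obtain ⟨b, hb⟩ := Finset.card_pos.1 (show 0 < p.2.card by omega)
    exact hm a ((h5 a ha b hb).trans_le (hM b))
  -- A lost pair has a chain through the layer `R`; removing that element leaves a `j`-chain below,
  -- and the antichain must lie in `T`.
  have hLc : L.card ≤ R.card * (T.card.choose (j + 1) * (rankChains ρ m j).card) := by
    rw [← Finset.card_powersetCard, ← Finset.card_product, ← Finset.card_product]
    refine (Finset.card_le_card (t := (R ×ˢ T.powersetCard (j + 1) ×ˢ rankChains ρ m j).image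
      fun q => (insert q.1 q.2.2, q.2.1)) ?_).trans Finset.card_image_le
    intro p hp
    obtain ⟨hp, x, hx, hxm⟩ := Finset.mem_filter.1 hp
    obtain ⟨h1, h2, h3, h4, h5⟩ := mem_chainAntichains.1 hp
    refine Finset.mem_image.2 ⟨(x, p.2, p.1.erase x), ?_, by simp [Finset.insert_erase hx]⟩
    simp only [Finset.mem_product, Finset.mem_powersetCard, mem_rankChains, memR]
    refine ⟨hxm, ⟨fun b hb => ?_, h2⟩, fun a ha => ?_, ?_, fun a ha b hb hab => ?_⟩
    · have h6 := h5 x hx b hb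
      have h7 := hM b
      have h8 := hm b
      rw [memT]
      omega
    · have h6 := hlow p hp a (Finset.mem_of_mem_erase ha)
      have h7 := h3 a (Finset.mem_of_mem_erase ha) x hx (Finset.ne_of_mem_erase ha)
      omega
    · rw [Finset.card_erase_of_mem hx, h1, Nat.add_sub_cancel]
    · have := h3 a (Finset.mem_of_mem_erase ha) b (Finset.mem_of_mem_erase hb) hab
      omega
  have hKO : K ⊆ O' := by
    intro p hp
    obtain ⟨hp, hn⟩ := Finset.mem_filter.1 hp
    obtain ⟨h1, h2, h3, h4, h5⟩ := mem_chainAntichains.1 hp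
    have hlt : ∀ a ∈ p.1, ρ a < m := fun a ha =>
      lt_of_le_of_ne (hlow p hp a ha) fun h => hn ⟨a, ha, h⟩
    refine mem_chainAntichains.2 ⟨h1, h2, ?_, ?_, ?_⟩
    · intro a ha b hb hab
      have := h3 a ha b hb hab
      have := hlt a ha
      have := hlt b hb
      omega
    · intro a ha b hb
      have := h4 a ha b hb
      omega
    · intro a ha b hb
      have := h5 a ha b hb
      have := hlt a ha
      omega
  -- New antichains mix the two merged layers; those with exactly one element of `R` are enough.
  set X := (R ×ˢ T.powersetCard j).image (fun q => insert q.1 q.2) with hX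
  have hRT : ∀ x ∈ R, ∀ B ⊆ T, x ∉ B := by
    intro x hx B hB h
    have := (memR x).1 hx
    have := (memT x).1 (hB h)
    omega
  have hXc : X.card = R.card * T.card.choose j := by
    rw [hX, Finset.card_image_of_injOn, Finset.card_product, Finset.card_powersetCard]
    rintro ⟨x, B⟩ hq ⟨x', B'⟩ hq' h
    simp only [Finset.coe_product, Set.mem_prod, Finset.mem_coe, Finset.mem_powersetCard] at hq hq'
    simp only at h
    have hxx : x = x' := by
      have : x ∈ insert x' B' := h ▸ Finset.mem_insert_self x B
      exact (Finset.mem_insert.1 this).resolve_right (hRT x hq.1 B' hq'.2.1)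
    subst hxx
    rw [← Finset.erase_insert (hRT x hq.1 B hq.2.1), h,
      Finset.erase_insert (hRT x hq.1 B' hq'.2.1)]
  set G := rankChains ρ m (j + 1) ×ˢ X with hG
  have hGp : ∀ p ∈ G, p ∈ O' ∧ p ∉ O := by
    rintro ⟨A, B⟩ hp
    simp only [hG, hX, Finset.mem_product, Finset.mem_image, Finset.mem_powersetCard,
      Prod.exists, mem_rankChains] at hp
    obtain ⟨⟨h1, h2, h3⟩, x, B, ⟨hx, hB, hBj⟩, rfl⟩ := hp
    have hge : ∀ b ∈ insert x B, m ≤ ρ b := by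
      intro b hb
      rcases Finset.mem_insert.1 hb with rfl | hb
      · exact ((memR b).1 hx).ge
      · have := (memT b).1 (hB hb)
        omega
    constructor
    · refine mem_chainAntichains.2 ⟨h2, ?_, ?_, ?_, ?_⟩
      · rw [Finset.card_insert_of_notMem (hRT x hx B hB), hBj]
      · intro a ha b hb hab
        have := h3 a ha b hb hab
        have := h1 a ha
        have := h1 b hb
        omega
      · intro a ha b hb
        have := hge a ha
        have := hge b hb
        omega
      · intro a ha b hb
        have := h1 a ha
        have := hge b hb
        omega
    · intro h
      obtain ⟨b, hb⟩ := Finset.card_pos.1 (show 0 < B.card by omega)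
      have h4 := (mem_chainAntichains.1 h).2.2.2.1 x (by simp) b (by simp [hb])
      have := (memR x).1 hx
      have := (memT b).1 (hB hb)
      omega
  have hdis : Disjoint K G := by
    rw [Finset.disjoint_left]
    exact fun p hp hq => (hGp p hq).2 (Finset.mem_filter.1 hp).1
  have h := Finset.card_le_card (Finset.union_subset hKO fun p hp => (hGp p hp).1)
  rw [Finset.card_union_of_disjoint hdis, hG, Finset.card_product, hXc] at h
  have : (rankChains ρ m (j + 1)).card * (R.card * T.card.choose j) =
      R.card * (T.card.choose j * (rankChains ρ m (j + 1)).card) := by ring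
  omega

end

/-! ### Optimal orders are block orders -/

section
variable {V : Type*} [Fintype V] {k : ℕ}

theorem IsOptimal.choose_sq_le {n : ℕ} (hcard : Fintype.card V = 2 * n) (hk : 2 ≤ k)
    {r : V → V → Prop} (h : IsOptimal k r) : n.choose k ^ 2 ≤ (chainAntichains r k).card := by
  obtain ⟨r', hr', hb⟩ := exists_isBlock (V := V) (n := n) (by omega)
  refine le_trans ?_ (h.2 r' hr')
  rw [hb.card_chainAntichains hr' hk, hcard, sq, show 2 * n - n = n by omega]

/-- An unbalanced block has fewer pairs than the balanced one, so it cannot match the optimum. -/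
theorem IsOptimal.not_isBlock {n s : ℕ} (hcard : Fintype.card V = 2 * n) (hk : 2 ≤ k)
    (hkn : k ≤ n) {r r' : V → V → Prop} (h : IsOptimal k r) (hr' : IsStrict r')
    (hle : (chainAntichains r k).card ≤ (chainAntichains r' k).card) (hb : IsBlock r' s) :
    s = n := by
  by_contra hne
  have h1 := hb.card_chainAntichains hr' hk
  obtain ⟨S, hS, -⟩ := hb
  have h2 := Finset.card_le_univ S
  have h3 := choose_mul_choose_lt (a := s) (b := Fintype.card V - s) (n := n) (k := k)
    (by omega) (by omega) hkn hne
  have h4 := h.choose_sq_le hcard hk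
  omega

theorem isBlock_min_rank {ρ : V → ℕ} {m : ℕ} (hinj : ∀ u w, u ≠ w → ρ u = ρ w → m ≤ ρ u) :
    IsBlock (fun u v => min (ρ u) m < min (ρ v) m)
      (Finset.univ.filter fun v => ρ v < m).card := by
  refine ⟨_, rfl, ?_, ?_, ?_⟩ <;> simp only [Finset.mem_filter, Finset.mem_univ, true_and]
  · intro s hs t ht hst
    have := hinj s t hst
    omega
  · intro s hs t ht
    omega
  · intro t ht t' ht'
    omega

theorem IsOptimal.isBlock_of_rank {n : ℕ} (hcard : Fintype.card V = 2 * n) (hk : 2 ≤ k)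
    (hkn : k ≤ n) {ρ : V → ℕ} (h : IsOptimal k fun u v => ρ u < ρ v) :
    IsBlock (fun u v => ρ u < ρ v) n := by
  classical
  have hpos : 0 < (chainAntichains (fun u v => ρ u < ρ v) k).card :=
    lt_of_lt_of_le (pow_pos (Nat.choose_pos hkn) 2) (h.choose_sq_le hcard hk)
  have huse := h.exists_uses hpos (by omega)
  have : Nonempty V := Fintype.card_pos_iff.1 (by omega)
  obtain ⟨top, htop⟩ := Finite.exists_max ρ
  set M := ρ top with hMdef
  set T := Finset.univ.filter fun v => ρ v = M with hT
  -- An element of top rank is used by some pair, necessarily in its antichain, which then lies in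
  -- the top layer.
  have hTk : k ≤ T.card := by
    obtain ⟨p, ⟨h1, h2, h3, h4, h5⟩, hp⟩ := huse top
    have htop2 : top ∈ p.2 := by
      refine hp.resolve_left fun hp => ?_
      obtain ⟨b, hb⟩ := Finset.card_pos.1 (show 0 < p.2.card by omega)
      exact absurd (h5 top hp b hb) (not_lt.2 (htop b))
    rw [← h2]
    refine Finset.card_le_card fun b hb => ?_
    have := h4 b hb top htop2
    have := htop b
    simp only [hT, Finset.mem_filter, Finset.mem_univ, true_and]
    omega
  have hex : ∃ m, 2 ≤ (Finset.univ.filter fun v => ρ v = m).card := ⟨M, hk.trans hTk⟩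
  obtain ⟨m₀, hP, hmin⟩ : ∃ m₀, 2 ≤ (Finset.univ.filter fun v => ρ v = m₀).card ∧
      ∀ m, 2 ≤ (Finset.univ.filter fun v => ρ v = m).card → m₀ ≤ m :=
    ⟨Nat.find hex, Nat.find_spec hex, fun m hm => Nat.find_min' hex hm⟩
  have hinj : ∀ u w, u ≠ w → ρ u = ρ w → m₀ ≤ ρ u := by
    intro u w hne he
    exact hmin _ (Finset.one_lt_card.2 ⟨u, by simp, w, by simp [he], hne⟩)
  set S := Finset.univ.filter fun v => ρ v < m₀ with hS
  rcases (hmin M (hk.trans hTk)).eq_or_lt with hmM | hmM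
  · have hb := isBlock_min_rank hinj
    have he : (fun u v => min (ρ u) m₀ < min (ρ v) m₀) = fun u v => ρ u < ρ v := by
      funext u v
      have := htop u
      have := htop v
      rw [min_eq_left (by omega), min_eq_left (by omega)]
    rw [he] at hb
    exact h.not_isBlock hcard hk hkn h.1 le_rfl hb ▸ hb
  exfalso
  rcases Nat.lt_or_ge S.card T.card with hST | hST
  · have := card_lt_card_layerToChain (ι := fun v => (Fintype.equivFin V v).val)
      (fun u v huv => (Fintype.equivFin V).injective (Fin.ext huv)) hk hmM hP hTk hST huse
    exact absurd (h.2 _ (isStrict_layerToChain _ _ _)) (not_le.2 this)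
  -- the second highest rank
  obtain ⟨x₀, hx₀⟩ : ∃ x, ρ x = m₀ := by
    obtain ⟨x, hx⟩ := Finset.card_pos.1 (show 0 < _ from lt_of_lt_of_le two_pos hP)
    exact ⟨x, by simpa using hx⟩
  obtain ⟨z, hz, hzmax⟩ := Finset.exists_max_image (Finset.univ.filter fun v => ρ v < M) ρ
    ⟨x₀, by simp; omega⟩
  set m := ρ z with hmdef
  have hmM' : m < M := by simpa using hz
  have hm : ∀ v, ρ v < M → ρ v ≤ m := fun v hv => hzmax v (by simpa using hv)
  have hm₀m : m₀ ≤ m := hx₀ ▸ hm x₀ (by omega)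
  obtain ⟨j, rfl⟩ : ∃ j, k = j + 1 := ⟨k - 1, by omega⟩
  have hmerge := card_add_le_card_mergeTop (j := j) (by omega) hmM' htop hm
  have hopt := h.2 (fun u v => min (ρ u) m < min (ρ v) m) (isStrict_rank fun v => min (ρ v) m)
  have hR : 0 < (Finset.univ.filter fun v => ρ v = m).card :=
    Finset.card_pos.2 ⟨z, by simp [hmdef]⟩
  set p := (Finset.univ.filter fun v => ρ v = m).card
  rw [← hT] at hmerge
  set c := (rankChains ρ m j).card with hc
  set c' := (rankChains ρ m (j + 1)).card
  set q := T.card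
  set s := S.card with hs
  -- Since `(j + 1) * q.choose (j + 1) = (q - j) * q.choose j`, the gain of merging covers the loss
  -- once `c * (q - j) ≤ c' * (j + 1)`, which follows from `q ≤ s`. Optimality then forces equality
  -- throughout.
  have hext : c * (s - j) ≤ c' * (j + 1) := card_rankChains_mul_le hm₀m hinj j
  have hcpos : 0 < c := by
    obtain ⟨A, hA, -⟩ := exists_rankChains_below (j := j) hm₀m hinj (show j ≤ s by omega)
    exact Finset.card_pos.2 ⟨A, hA⟩
  have hq : 0 < q.choose j := Nat.choose_pos (by omega)
  have hqj := Nat.choose_succ_right_eq q j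
  have hge : c * (q - j) ≤ c' * (j + 1) :=
    (Nat.mul_le_mul_left c (by omega)).trans hext
  have hle : p * (q.choose (j + 1) * c) ≤ p * (q.choose j * c') := by
    refine Nat.mul_le_mul_left p (Nat.le_of_mul_le_mul_right ?_ (show 0 < j + 1 by omega))
    calc q.choose (j + 1) * c * (j + 1) = q.choose j * (c * (q - j)) := by
          rw [mul_right_comm, hqj]; ring
      _ ≤ q.choose j * (c' * (j + 1)) := Nat.mul_le_mul_left _ hge
      _ = _ := by ring
  have hnlt : ¬ c * (q - j) < c' * (j + 1) := by
    intro hlt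
    have : p * (q.choose (j + 1) * c) < p * (q.choose j * c') := by
      refine Nat.mul_lt_mul_of_pos_left (Nat.lt_of_mul_lt_mul_right (a := j + 1) ?_) hR
      calc q.choose (j + 1) * c * (j + 1) = q.choose j * (c * (q - j)) := by
            rw [mul_right_comm, hqj]; ring
        _ < q.choose j * (c' * (j + 1)) := Nat.mul_lt_mul_of_pos_left hlt hq
        _ = _ := by ring
    omega
  have hsq : s = q := by
    by_contra hne
    exact hnlt ((Nat.mul_lt_mul_of_pos_left (by omega) hcpos).trans_le hext)
  have hmm : m₀ = m := by
    by_contra hne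
    have := card_rankChains_mul_lt (j := j) (lt_of_le_of_ne hm₀m hne) hinj
      (show j ≤ s by omega) ⟨x₀, hx₀⟩
    rw [← hc, ← hS, ← hs, hsq] at this
    exact hnlt this
  -- Merging now yields a block that is still optimal, so `S` and `T` both have `n` elements,
  -- leaving no room for `x₀`.
  rw [← hmm] at hmerge hopt
  have hsn : s = n := h.not_isBlock hcard hk hkn
    (isStrict_rank fun v => min (ρ v) m₀) (by omega) (isBlock_min_rank hinj)
  have hdis1 : Disjoint S T := by
    rw [Finset.disjoint_left]
    intro a ha hb
    simp only [hS, hT, Finset.mem_filter, Finset.mem_univ, true_and] at ha hb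
    omega
  have hlt : (S ∪ T).card < Fintype.card V := by
    rw [← Finset.card_univ]
    refine Finset.card_lt_card (Finset.ssubset_univ_iff.2 fun hu => ?_)
    have : x₀ ∈ S ∪ T := hu ▸ Finset.mem_univ _
    simp only [hS, hT, Finset.mem_union, Finset.mem_filter, Finset.mem_univ, true_and] at this
    omega
  rw [Finset.card_union_of_disjoint hdis1] at hlt
  omega

/-- On `2 * n` elements, an optimal order is a chain of size `n` below an antichain. -/
theorem IsOptimal.isBlock {n : ℕ} (hcard : Fintype.card V = 2 * n) (hk : 2 ≤ k)
    (hkn : k ≤ n) {r : V → V → Prop} (h : IsOptimal k r) : IsBlock r n := by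
  classical
  refine isBlock_of_forall_not_isBad hcard hk hkn (fun r h hbad => ?_) r h
  obtain ⟨ρ, rfl⟩ := exists_rank h.1 hbad
  exact h.isBlock_of_rank hcard hk hkn

theorem card_chainAntichains_le {n : ℕ} (hcard : Fintype.card V = 2 * n) (hk : 2 ≤ k)
    (hkn : k ≤ n) {r : V → V → Prop} (hr : IsStrict r) :
    (chainAntichains r k).card ≤ n.choose k ^ 2 ∧
      ((chainAntichains r k).card = n.choose k ^ 2 → IsBlock r n) := by
  have : Nonempty {r : V → V → Prop // IsStrict r} := ⟨⟨r, hr⟩⟩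
  obtain ⟨⟨r₀, hr₀⟩, hmax⟩ := Finite.exists_max
    fun r : {r : V → V → Prop // IsStrict r} => (chainAntichains r.1 k).card
  have hopt : IsOptimal k r₀ := ⟨hr₀, fun r' hr' => hmax ⟨r', hr'⟩⟩
  have hval : (chainAntichains r₀ k).card = n.choose k ^ 2 := by
    rw [(hopt.isBlock hcard hk hkn).card_chainAntichains hr₀ hk, hcard, sq,
      show 2 * n - n = n by omega]
  refine ⟨hval ▸ hopt.2 r hr, fun h => ?_⟩
  refine IsOptimal.isBlock hcard hk hkn (k := k) ⟨hr, fun r' hr' => ?_⟩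
  rw [h, ← hval]
  exact hopt.2 r' hr'

end

/-! ### From orders back to permutations -/

/-- The order on positions in which `u` lies below `v` if both its position and its value are
smaller. -/
def permRel {N : ℕ} (σ : Equiv.Perm (Fin N)) : Fin N → Fin N → Prop :=
  fun u v => u < v ∧ σ u < σ v

theorem isStrict_permRel {N : ℕ} (σ : Equiv.Perm (Fin N)) : IsStrict (permRel σ) :=
  ⟨fun _ h => lt_irrefl _ h.1, fun _ _ _ h h' => ⟨h.1.trans h'.1, h.2.trans h'.2⟩⟩

theorem blockPerm_val (k : ℕ) (i : Fin (2 * k)) :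
    (blockPerm k i).val = if i.val < k then i.val else 3 * k - 1 - i.val := by
  change (blockFun k i).val = _
  unfold blockFun
  split_ifs <;> rfl

theorem blockPerm_lt_iff {k : ℕ} (i j : Fin (2 * k)) :
    blockPerm k i < blockPerm k j ↔
      (i.val < k ∧ (i.val < j.val ∨ k ≤ j.val)) ∨ (k ≤ j.val ∧ j.val < i.val) := by
  rw [Fin.lt_def, blockPerm_val, blockPerm_val]
  have := i.isLt
  have := j.isLt
  split_ifs <;> omega

/-- Splitting an occurrence into its first and last `k` positions gives a pair whose union recovers
the occurrence. -/
theorem numOccurrences_le_card {k N : ℕ} (σ : Equiv.Perm (Fin N)) :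
    numOccurrences (blockPerm k) σ ≤ (chainAntichains (permRel σ) k).card := by
  refine (Finset.card_le_card (t := (chainAntichains (permRel σ) k).image fun p => p.1 ∪ p.2)
    fun S hS => ?_).trans Finset.card_image_le
  obtain ⟨h, hocc⟩ := (Finset.mem_filter.1 hS).2
  set e := S.orderEmbOfFin h with he
  have hval : ∀ i j, σ (e i) < σ (e j) ↔ _ := fun i j => (hocc i j).trans (blockPerm_lt_iff i j)
  have hlow : (Finset.univ.filter fun i : Fin (2 * k) => i.val < k).card = k := by
    rw [Fin.card_filter_val_lt]
    omega
  have hhigh : (Finset.univ.filter fun i : Fin (2 * k) => ¬ i.val < k).card = k := by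
    have := Finset.card_filter_add_card_filter_not (s := Finset.univ)
      (fun i : Fin (2 * k) => i.val < k)
    rw [hlow, Finset.card_univ, Fintype.card_fin] at this
    omega
  refine Finset.mem_image.2 ⟨((Finset.univ.filter fun i : Fin (2 * k) => i.val < k).map
    e.toEmbedding, (Finset.univ.filter fun i : Fin (2 * k) => ¬ i.val < k).map e.toEmbedding),
    mem_chainAntichains.2 ⟨?_, ?_, ?_, ?_, ?_⟩, ?_⟩
  · rw [Finset.card_map, hlow]
  · rw [Finset.card_map, hhigh]
  · simp only [Finset.mem_map, Finset.mem_filter, Finset.mem_univ, true_and]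
    rintro _ ⟨i, hi, rfl⟩ _ ⟨j, hj, rfl⟩ hij
    have hne : i ≠ j := fun h => hij (by rw [h])
    change permRel σ (e i) (e j) ∨ permRel σ (e j) (e i)
    simp only [permRel, hval, OrderEmbedding.lt_iff_lt, Fin.lt_def]
    have := Fin.val_ne_of_ne hne
    omega
  · simp only [Finset.mem_map, Finset.mem_filter, Finset.mem_univ, true_and]
    rintro _ ⟨i, hi, rfl⟩ _ ⟨j, hj, rfl⟩
    change ¬ permRel σ (e i) (e j)
    simp only [permRel, hval, OrderEmbedding.lt_iff_lt, Fin.lt_def]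
    omega
  · simp only [Finset.mem_map, Finset.mem_filter, Finset.mem_univ, true_and]
    rintro _ ⟨i, hi, rfl⟩ _ ⟨j, hj, rfl⟩
    change permRel σ (e i) (e j)
    simp only [permRel, hval, OrderEmbedding.lt_iff_lt, Fin.lt_def]
    omega
  · simp only
    rw [← Finset.map_union, Finset.filter_union_filter_not_eq, he]
    ext v
    simp

theorem numOccurrences_eq_zero {m n : ℕ} (τ : Equiv.Perm (Fin m)) (σ : Equiv.Perm (Fin n))
    (h : n < m) : numOccurrences τ σ = 0 := by
  refine Finset.card_eq_zero.2 (Finset.filter_eq_empty_iff.2 ?_)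
  rintro S - ⟨hS, -⟩
  have := Finset.card_le_univ S
  rw [Fintype.card_fin] at this
  omega

theorem isOccurrence_blockPerm {k n : ℕ} {S : Finset (Fin (2 * n))} (hS : S.card = 2 * k)
    (hlow : (S.filter fun v => v.val < n).card = k) :
    IsOccurrence (blockPerm k) (blockPerm n) S := by
  refine ⟨hS, fun i j => ?_⟩
  set e := S.orderEmbOfFin hS with he
  have hcard : (Finset.univ.filter fun i => (e i).val < n).card = k := by
    refine Eq.trans ?_ hlow
    rw [← Finset.card_map e.toEmbedding]
    congr 1
    ext v
    have := Set.ext_iff.1 (Finset.range_orderEmbOfFin S hS) v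
    simp only [Set.mem_range, Finset.mem_coe] at this
    simp only [Finset.mem_map, Finset.mem_filter, Finset.mem_univ, true_and, ← this]
    constructor
    · rintro ⟨i, hi, rfl⟩
      exact ⟨⟨i, rfl⟩, hi⟩
    · rintro ⟨⟨i, rfl⟩, hi⟩
      exact ⟨i, hi, rfl⟩
  -- As `e` is increasing, the indices sent below `n` form an initial segment, and there are `k` of
  -- them.
  have hiff : ∀ i, (e i).val < n ↔ i.val < k := by
    intro i
    constructor
    · intro hi
      have : (Finset.univ.filter fun j : Fin (2 * k) => j.val < i.val + 1) ⊆
          Finset.univ.filter fun i => (e i).val < n := by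
        intro j hj
        simp only [Finset.mem_filter, Finset.mem_univ, true_and] at hj ⊢
        have : e j ≤ e i := e.monotone (Fin.le_def.2 (by omega))
        exact (Fin.le_def.1 this).trans_lt hi
      have := Finset.card_le_card this
      rw [hcard, Fin.card_filter_val_lt] at this
      omega
    · intro hi
      by_contra hn
      have : (Finset.univ.filter fun i => (e i).val < n) ⊆
          Finset.univ.filter fun j : Fin (2 * k) => j.val < i.val := by
        intro j hj
        simp only [Finset.mem_filter, Finset.mem_univ, true_and] at hj ⊢
        by_contra hij
        have : e i ≤ e j := e.monotone (Fin.le_def.2 (by omega))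
        have := Fin.le_def.1 this
        omega
      have := Finset.card_le_card this
      rw [hcard, Fin.card_filter_val_lt] at this
      omega
  have h1 := hiff i
  have h2 := hiff j
  have h3 : (e i).val < (e j).val ↔ i.val < j.val := by
    rw [← Fin.lt_def, ← Fin.lt_def, OrderEmbedding.lt_iff_lt]
  have h4 : (e j).val < (e i).val ↔ j.val < i.val := by
    rw [← Fin.lt_def, ← Fin.lt_def, OrderEmbedding.lt_iff_lt]
  rw [blockPerm_lt_iff, blockPerm_lt_iff]
  omega

theorem choose_sq_le_numOccurrences (k n : ℕ) :
    n.choose k ^ 2 ≤ numOccurrences (blockPerm k) (blockPerm n) := by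
  set L : Finset (Fin (2 * n)) := Finset.univ.filter fun v => v.val < n with hL
  have hLc : L.card = n := by
    rw [hL, Fin.card_filter_val_lt]
    omega
  have hLc' : Lᶜ.card = n := by
    rw [Finset.card_compl, hLc, Fintype.card_fin]
    omega
  have hsplit : ∀ A ⊆ L, ∀ B ⊆ Lᶜ, (A ∪ B).filter (fun v => v.val < n) = A ∧
      (A ∪ B).filter (fun v => ¬ v.val < n) = B := by
    intro A hA B hB
    have hA' : ∀ a ∈ A, a.val < n := fun a ha => by simpa [hL] using hA ha
    have hB' : ∀ b ∈ B, ¬ b.val < n := fun b hb => by simpa [hL] using hB hb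
    constructor <;> ext v <;> simp only [Finset.mem_filter, Finset.mem_union] <;>
      have := hA' v <;> have := hB' v <;> tauto
  calc n.choose k ^ 2 = (L.powersetCard k ×ˢ Lᶜ.powersetCard k).card := by
        rw [Finset.card_product, Finset.card_powersetCard, Finset.card_powersetCard, hLc, hLc', sq]
    _ ≤ numOccurrences (blockPerm k) (blockPerm n) := by
        refine Finset.card_le_card_of_injOn (fun p => p.1 ∪ p.2) ?_ ?_
        · rintro ⟨A, B⟩ hp
          simp only [Finset.coe_product, Set.mem_prod, Finset.mem_coe,
            Finset.mem_powersetCard] at hp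
          obtain ⟨⟨hA, hAk⟩, hB, hBk⟩ := hp
          simp only [Finset.coe_filter, Finset.mem_univ, true_and, Set.mem_ofPred_eq]
          refine isOccurrence_blockPerm ?_ ?_
          · rw [Finset.card_union_of_disjoint
              (Finset.disjoint_of_subset_left hA
                (Finset.disjoint_of_subset_right hB disjoint_compl_right)), hAk, hBk]
            omega
          · rw [(hsplit A hA B hB).1, hAk]
        · rintro ⟨A, B⟩ hp ⟨A', B'⟩ hp' h
          simp only [Finset.coe_product, Set.mem_prod, Finset.mem_coe,
            Finset.mem_powersetCard] at hp hp' h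
          have h1 := hsplit A hp.1.1 B hp.2.1
          have h2 := hsplit A' hp'.1.1 B' hp'.2.1
          rw [h] at h1
          rw [← h1.1, ← h1.2, h2.1, h2.2]

theorem perm_eq_of_forall_lt_iff {N : ℕ} {σ τ : Equiv.Perm (Fin N)}
    (h : ∀ u v, σ u < σ v ↔ τ u < τ v) : σ = τ := by
  have hmono : StrictMono (τ.symm.trans σ) := fun a b hab => by
    simpa [h] using hab
  have hid : ⇑(τ.symm.trans σ) = id :=
    hmono.range_inj strictMono_id |>.1 (by simp)
  ext v
  have := congrFun hid (τ v)
  simp only [Equiv.trans_apply, Equiv.symm_apply_apply, id] at this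
  rw [this]

/-- Elements of `S` precede all others in position, so `S` is the set of the first `n` positions;
the block relations then fix the order of all values. -/
theorem eq_blockPerm_of_isBlock {n : ℕ} {σ : Equiv.Perm (Fin (2 * n))}
    (h : IsBlock (permRel σ) n) : σ = blockPerm n := by
  obtain ⟨S, hS, hch, hST, hT⟩ := h
  have hmem : ∀ v, v ∈ S ↔ v.val < n := by
    intro v
    constructor
    · intro hv
      have : (Finset.univ.filter fun u : Fin (2 * n) => u.val < v.val + 1) ⊆ S := by
        intro u hu
        simp only [Finset.mem_filter, Finset.mem_univ, true_and] at hu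
        by_contra huS
        have := Fin.lt_def.1 (hST v hv u huS).1
        omega
      have := Finset.card_le_card this
      rw [hS, Fin.card_filter_val_lt] at this
      omega
    · intro hv
      by_contra hvS
      have : S ⊆ Finset.univ.filter fun u : Fin (2 * n) => u.val < v.val := by
        intro u hu
        simpa using (hST u hu v hvS).1
      have := Finset.card_le_card this
      rw [hS, Fin.card_filter_val_lt] at this
      omega
  refine perm_eq_of_forall_lt_iff fun u v => ?_
  rw [blockPerm_lt_iff]
  have hσ : σ u = σ v → u = v := fun h => σ.injective h
  rcases eq_or_ne u v with rfl | huv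
  · simp
  have hu := hmem u
  have hv := hmem v
  simp only [permRel, Fin.lt_def, Fin.ext_iff, ne_eq] at *
  by_cases h1 : u ∈ S <;> by_cases h2 : v ∈ S <;> simp only [h1, h2, true_iff, false_iff] at hu hv
  · have := hch u h1 v h2
    omega
  · have := hST u h1 v h2
    omega
  · have := hST v h2 u h1
    omega
  · have := hT u h1 v h2
    have := hT v h2 u h1
    omega

theorem numOccurrences_le_choose_sq {k n : ℕ} (hk : 2 ≤ k) (σ : Equiv.Perm (Fin (2 * n))) :
    numOccurrences (blockPerm k) σ ≤ n.choose k ^ 2 := by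
  rcases Nat.lt_or_ge n k with hnk | hkn
  · rw [numOccurrences_eq_zero _ _ (by omega)]
    exact Nat.zero_le _
  · exact (numOccurrences_le_card σ).trans
      (card_chainAntichains_le (Fintype.card_fin _) hk hkn (isStrict_permRel σ)).1

theorem maxOccurrences_blockPerm {k : ℕ} (hk : 2 ≤ k) (n : ℕ) :
    maxOccurrences (blockPerm k) (2 * n) = n.choose k ^ 2 :=
  le_antisymm (Finset.sup'_le _ _ fun σ _ => numOccurrences_le_choose_sq hk σ)
    ((choose_sq_le_numOccurrences k n).trans
      (Finset.le_sup' (fun σ => numOccurrences (blockPerm k) σ) (Finset.mem_univ (blockPerm n))))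

theorem mainTheorem1 (α n : ℕ) (hα : 2 ≤ α) :
    maxOccurrences (blockPerm α) (2 * n) = n.choose α ^ 2 ∧
    IsPatternMaximal (blockPerm α) (blockPerm n) ∧
    (α ≤ n → ∀ σ : Equiv.Perm (Fin (2 * n)),
      IsPatternMaximal (blockPerm α) σ → σ = blockPerm n) := by
  have hmax := maxOccurrences_blockPerm hα n
  refine ⟨hmax, ?_, fun hn σ hσ => ?_⟩
  · rw [IsPatternMaximal, hmax]
    exact le_antisymm (numOccurrences_le_choose_sq hα _) (choose_sq_le_numOccurrences α n)
  · rw [IsPatternMaximal, hmax] at hσ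
    have h := card_chainAntichains_le (Fintype.card_fin _) hα hn (isStrict_permRel σ)
    exact eq_blockPerm_of_isBlock (h.2 (le_antisymm h.1 (hσ ▸ numOccurrences_le_card σ)))
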